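/- Conventions. A $*$-field is a (commutative) field $F$ with an involution $r\mapsto r^*$ (a ring automorphism with $r^{**}=r$, possibly the identity). A $d$-dimensional inner product space over $F$ is an $F$-vector space $V$ with $\dim V=d$ and a form $\langle\cdot|\cdot\rangle$ that is additive in both arguments and satisfies $\langle vr|ws\rangle=r^*\langle v|w\rangle s$, $\langle w|v\rangle=\langle v|w\rangle^*$, is non-degenerate, and is non-alternate ($\langle v|v\rangle\ne 0$ for some $v$). $\mathsf L(V)$ is the lattice of all subspaces of $V$ with operations $0$, $+$ and $U\mapsto U^\perp=\{x\mid \langle x|u\rangle=0\ \forall u\in U\}$. Write $|v|=\langle v|v\rangle$. A $\perp$-basis is a basis $\bar v=(v_1,\dots,v_d)$ of $V$ with $\langle v_i|v_j\rangle=0$ for $i\neq j$, and then $|\bar v|=(1,|v_1|^{-1}|v_2|,\dots,|v_1|^{-1}|v_d|)$. A tuple $\bar\alpha\in F^d$ is admissible for $V$ if $\alpha_1=1$, $\alpha_i=\alpha_i^*\neq 0$ for all $i$, and $\bar\alpha=|\bar v|$ for some $\perp$-basis $\bar v$ of $V$. For $M\subseteq \mathsf L(V)^n$ let $\theta_{L\bar\alpha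 F}(M)\subseteq(F^{d\times d})^n$ be the set of all $(A_1,\dots,A_n)$ for which there is a $\perp$-basis $\bar v$ with $|\bar v|=\bar\alpha$ such that $(U_1,\dots,U_n)\in M$, where $U_k$ is the span of the vectors $\sum_{i=1}^d (A_k)_{ij}v_i$ $(j=1,\dots,d)$. Let $\Lambda_L$ be the set of first-order formulas in the signature $+,0,{}^\perp$, let $\Lambda_F$ be the set of first-order formulas in the signature of $*$-rings with constants $0,1$, and let $\Lambda_F^+$ be the same with additional constants $\bar c=(c_1,\dots,c_d)$. Theorem. Fix $d\ge 1$. There is a map $\tau:\Lambda_L\to\Lambda_F^+$ which sends a formula $\varphi(x_1,\dots,x_n)$ to a formula $\tau(\varphi)(X_1,\dots,X_n)$, where the $X_k$ are $d\times d$-matrices of variables, such that the following hold. (1) If $\varphi$ is quantifier free, then so is $\tau(\varphi)$. (2) For every $*$-field $F$, every $d$-dimensional inner product space $V$ over $F$, every $\bar\alpha$ admissible for $V$, and every $n$: if $\varphi(x_1,\dots,x_n)\in\Lambda_L$ defines $M\subseteq \mathsf L(V)^n$ in $\mathsf L(V)$, then $\tau(\varphi)(X_1,\dots,X_n)$, with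 $\bar c$ interpreted as $\bar\alpha$, defines $\theta_{L\bar\alpha F}(M)\subseteq (F^{d\times d})^n$ in $F$. (3) For every $*$-field $F$ and every $\bar\alpha\in F_0^d$, where $F_0$ is the prime subfield of $F$, the formula obtained from $\tau(\varphi)$ by substituting $\bar\alpha$ for $\bar c$ can be taken in $\Lambda_F$: there is a map $\tau_{\bar\alpha}:\Lambda_L\to\Lambda_F$ such that, for every $\varphi\in\Lambda_L$, $\tau_{\bar\alpha}(\varphi)$ defines in $F$ the same set of $n$-tuples of matrices as $\tau(\varphi)$ with $\bar c$ interpreted as $\bar\alpha$, and $\tau_{\bar\alpha}(\varphi)$ is quantifier free if $\varphi$ is. In particular, for every $d$-dimensional inner product space $V$ over $F$ for which $\bar\alpha$ is admissible, $\tau_{\bar\alpha}(\varphi)$ defines $\theta_{L\bar\alpha F}(M)$ in $F$ whenever $\varphi$ defines $M\subseteq\mathsf L(V)^n$. -/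

import Mathlib

universe u v

namespace SubspaceTranslation

open FirstOrder

/-! ### The three first-order languages -/

/-- Operation symbols of bounded lattices with involution: `0`, `+` and `⊥`.
Meet and `1` are the derived terms `(sᗮ + tᗮ)ᗮ` and `0ᗮ`. -/
inductive LatFunc : ℕ → Type
  | zero : LatFunc 0
  | add : LatFunc 2
  | perp : LatFunc 1

/-- The language `Λ_L` of bounded lattices with involution. There are no relation symbols, so
that the atomic formulas are the equations between terms. -/
def latLang : FirstOrder.Language.{0, 0} where
  Functions := LatFunc
  Relations := fun _ => Empty

/-- Operation symbols of `*`-rings with `0` and `1`. -/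
inductive StarRingFunc : ℕ → Type
  | zero : StarRingFunc 0
  | one : StarRingFunc 0
  | neg : StarRingFunc 1
  | star : StarRingFunc 1
  | add : StarRingFunc 2
  | mul : StarRingFunc 2

/-- The language `Λ_F` of `*`-rings. -/
def starLang : FirstOrder.Language.{0, 0} where
  Functions := StarRingFunc
  Relations := fun _ => Empty

/-- The language `Λ_F⁺`: the language of `*`-rings with additional constants `c₁, …, c_d`. -/
def starLangPlus (d : ℕ) : FirstOrder.Language.{0, 0} := starLang.withConstants (Fin d)

/-! ### `*`-fields as structures -/

section StarFields

variable (F : Type u) [Field F] [StarRing F]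

/-- A `*`-field as a structure for `Λ_F`. -/
@[reducible] def starStructure : starLang.Structure F where
  funMap := fun {_} f x =>
    match f with
    | .zero => 0
    | .one => 1
    | .neg => -x 0
    | .star => star (x 0)
    | .add => x 0 + x 1
    | .mul => x 0 * x 1
  RelMap := fun r _ => r.elim

variable {F}

/-- A `*`-field as a structure for `Λ_F⁺`, the constant `c_i` being interpreted as `α_i`. -/
@[reducible] def starStructurePlus {d : ℕ} (α : Fin d → F) : (starLangPlus d).Structure F :=
  letI := starStructure F
  letI := FirstOrder.Language.constantsOn.structure α
  inferInstanceAs ((starLang.sum (FirstOrder.Language.constantsOn (Fin d))).Structure F)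

/-- The assignment to the variables `x_{kij}`, arranged as `n` matrices of variables, that is
given by an `n`-tuple of matrices. -/
def entries {n d : ℕ} (A : Fin n → Matrix (Fin d) (Fin d) F) : Fin n × Fin d × Fin d → F :=
  fun p => A p.1 p.2.1 p.2.2

/-- `ψ(X₁, …, X_n)` in `Λ_F` defines the set `K` of `n`-tuples of matrices over `F`. -/
def DefinesMat {n d : ℕ} (ψ : starLang.Formula (Fin n × Fin d × Fin d))
    (K : Set (Fin n → Matrix (Fin d) (Fin d) F)) : Prop :=
  letI := starStructure F
  ∀ A, A ∈ K ↔ ψ.Realize (entries A)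

/-- `ψ(X₁, …, X_n)` in `Λ_F⁺`, with the constants `c_i` interpreted as `α_i`, defines the set `K`
of `n`-tuples of matrices over `F`. -/
def DefinesMatPlus {n d : ℕ} (α : Fin d → F)
    (ψ : (starLangPlus d).Formula (Fin n × Fin d × Fin d))
    (K : Set (Fin n → Matrix (Fin d) (Fin d) F)) : Prop :=
  letI := starStructurePlus α
  ∀ A, A ∈ K ↔ ψ.Realize (entries A)

end StarFields

/-! ### Inner product spaces and their subspace lattices -/

section Spaces

variable {F : Type u} [Field F] [StarRing F] {V : Type v} [AddCommGroup V] [Module F V]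

/-- A form: a map that is conjugate linear in the first and linear in the second argument,
`*`-hermitean, non-degenerate and non-alternate. -/
structure IsForm (B : V →ₗ⋆[F] V →ₗ[F] F) : Prop where
  hermitean : ∀ x y, B y x = star (B x y)
  nondegenerate : ∀ y, (∀ x, B x y = 0) → y = 0
  nonalternate : ∃ x, B x x ≠ 0

/-- The lattice of subspaces with the involution `Uᗮ = {x | ⟨u | x⟩ = 0 for all u ∈ U}` as a
structure for `Λ_L`. As forms are hermitean, `⟨u | x⟩ = 0` and `⟨x | u⟩ = 0` mean the same. -/
@[reducible] def latStructure (B : V →ₗ⋆[F] V →ₗ[F] F) :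
    latLang.Structure (Submodule F V) where
  funMap := fun {_} f x =>
    match f with
    | .zero => ⊥
    | .add => x 0 ⊔ x 1
    | .perp => (x 0).orthogonalBilin B
  RelMap := fun r _ => r.elim

/-- `φ(x₁, …, x_n)` in `Λ_L` defines the set `M` of `n`-tuples of subspaces. -/
def DefinesSub (B : V →ₗ⋆[F] V →ₗ[F] F) {n : ℕ} (φ : latLang.Formula (Fin n))
    (M : Set (Fin n → Submodule F V)) : Prop :=
  letI := latStructure B
  ∀ U, U ∈ M ↔ φ.Realize U

variable {d : ℕ}

/-- A `⊥`-basis `v` with `|v| = α`, where `|v| = (1, |v₁|⁻¹|v₂|, …, |v₁|⁻¹|v_d|)` and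
`|v_i| = ⟨v_i | v_i⟩`. -/
structure IsPerpBasis [NeZero d] (B : V →ₗ⋆[F] V →ₗ[F] F) (α : Fin d → F)
    (v : Module.Basis (Fin d) F V) : Prop where
  orthogonal : ∀ i j, i ≠ j → B (v i) (v j) = 0
  ratio : ∀ i, α i = (B (v 0) (v 0))⁻¹ * B (v i) (v i)

/-- `α` is admissible with respect to the inner product space `V`. -/
structure IsAdmissible [NeZero d] (B : V →ₗ⋆[F] V →ₗ[F] F) (α : Fin d → F) : Prop where
  first : α 0 = 1
  selfadjoint : ∀ i, star (α i) = α i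
  ne_zero : ∀ i, α i ≠ 0
  exists_basis : ∃ v : Module.Basis (Fin d) F V, IsPerpBasis B α v

/-- The span of the columns of `A` when `V` is identified with `F^d` via the basis `v`. -/
def colSpan (v : Module.Basis (Fin d) F V) (A : Matrix (Fin d) (Fin d) F) : Submodule F V :=
  Submodule.span F (Set.range fun j => ∑ i, A i j • v i)

/-- `θ_{L v F}(M)`: the tuples of matrices whose column spans (with respect to `v`) are in `M`. -/
def thetaBasis (v : Module.Basis (Fin d) F V) {n : ℕ} (M : Set (Fin n → Submodule F V)) :
    Set (Fin n → Matrix (Fin d) (Fin d) F) :=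
  {A | (fun k => colSpan v (A k)) ∈ M}

/-- `θ_{L α F}(M)`: the union of the `θ_{L v F}(M)` over all `⊥`-bases `v` with `|v| = α`. -/
def theta [NeZero d] (B : V →ₗ⋆[F] V →ₗ[F] F) (α : Fin d → F) {n : ℕ}
    (M : Set (Fin n → Submodule F V)) : Set (Fin n → Matrix (Fin d) (Fin d) F) :=
  {A | ∃ v : Module.Basis (Fin d) F V, IsPerpBasis B α v ∧ A ∈ thetaBasis v M}

end Spaces

end SubspaceTranslation

namespace SubspaceTranslation

open FirstOrder FirstOrder.Language

/-! ### Linear algebra -/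

section LinearAlgebra

variable {F : Type u} [Field F] {V : Type v} [AddCommGroup V] [Module F V]

/-! A `⊥`-basis `v` with `|v| = α` identifies `V` with `F^d` so that the form becomes the diagonal
form with weights `α`, up to the nonzero factor `|v₁|`, which orthogonality does not see
(`IsPerpBasis.latEquiv`). Column spans become column spaces, so all such `v` give the same set of
matrices, and it remains to express the truth of a formula in the lattice of subspaces of `F^d`
(`IsAdmissible.mem_theta_iff`).

There a lattice term is evaluated to a finite list of vectors of ring terms that span its value.
Sums concatenate lists; for orthocomplements, the functionals given by the generators are eliminated
one at a time from the standard basis. Each elimination needs only products and differences, by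
`span_inf_ker_of_ne_zero`, but depends on whether the functional vanishes on the current generators.
The list is thus not uniform in the matrices, so the formula is built from a continuation `k`, with
one copy in each branch of a quantifier free case distinction. Equality is mutual inclusion, tested
through annihilators (`Interprets.realize_leFormula`). A quantifier over subspaces becomes one over
`d × d` matrices, by `exists_span_range_eq`.

The weights matter only up to a common nonzero factor, so weights in the prime field can be replaced
by integers, which are terms of the language. -/

/-- The map `y ↦ f a • y - f y • a` sends the span of `S` into the right-hand side and is
multiplication by `f a ≠ 0` on the kernel of `f`. Taking all pairs from `S` makes the generators
independent of the choice of `a`. -/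
theorem span_inf_ker_of_ne_zero (f : V →ₗ[F] F) (S : Set V) {a : V} (ha : a ∈ S) (hfa : f a ≠ 0) :
    Submodule.span F S ⊓ LinearMap.ker f =
      Submodule.span F {x | ∃ b ∈ S, ∃ b' ∈ S, f b • b' - f b' • b = x} := by
  apply le_antisymm
  · rintro x ⟨hx, hfx⟩
    have key : ∀ y ∈ Submodule.span F S, f a • y - f y • a ∈
        Submodule.span F {x | ∃ b ∈ S, ∃ b' ∈ S, f b • b' - f b' • b = x} := by
      intro y hy
      induction hy using Submodule.span_induction with
      | mem y hy => exact Submodule.subset_span ⟨a, ha, y, hy, rfl⟩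
      | zero => simp
      | add y z _ _ hy hz =>
        convert Submodule.add_mem _ hy hz using 1
        simp only [map_add, smul_add, add_smul]
        abel
      | smul c y _ hy =>
        convert Submodule.smul_mem _ c hy using 1
        simp only [map_smul, smul_sub, smul_smul, smul_eq_mul, mul_comm]
    have h := Submodule.smul_mem _ (f a)⁻¹ (key x hx)
    rw [LinearMap.mem_ker.1 hfx, zero_smul, sub_zero, smul_smul, inv_mul_cancel₀ hfa,
      one_smul] at h
    exact h
  · rw [Submodule.span_le]
    rintro _ ⟨b, hb, b', hb', rfl⟩
    refine ⟨Submodule.sub_mem _ (Submodule.smul_mem _ _ (Submodule.subset_span hb'))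
      (Submodule.smul_mem _ _ (Submodule.subset_span hb)), ?_⟩
    simp [mul_comm]

/-- A vector lies in a subspace of `F^d` as soon as every dot product annihilating the subspace
annihilates the vector. -/
theorem mem_of_dotProduct_annihilator {d : ℕ} (W : Submodule F (Fin d → F)) (x : Fin d → F)
    (h : ∀ p : Fin d → F, (∀ y ∈ W, y ⬝ᵥ p = 0) → p ⬝ᵥ x = 0) : x ∈ W := by
  by_contra hx
  obtain ⟨f, hfx, hf⟩ := Submodule.exists_le_ker_of_notMem hx
  have hdot : ∀ y, f y = (fun i => f (Pi.single i 1)) ⬝ᵥ y := by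
    intro y
    rw [LinearMap.pi_apply_eq_sum_univ f y]
    simp only [dotProduct, smul_eq_mul]
    refine Finset.sum_congr rfl fun i _ => ?_
    rw [mul_comm]
    congr 2
    ext j
    simp [Pi.single_apply, eq_comm]
  apply hfx
  rw [hdot]
  apply h
  intro y hy
  rw [dotProduct_comm, ← hdot]
  exact hf hy

/-- A basis of `U` has at most `d` elements; the remaining columns are filled with zeros. -/
theorem exists_span_range_eq {d : ℕ} (U : Submodule F (Fin d → F)) :
    ∃ A : Matrix (Fin d) (Fin d) F, Submodule.span F (Set.range fun j i => A i j) = U := by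
  let b := Module.finBasis F U
  have hle : Module.finrank F U ≤ d := by
    simpa using Submodule.finrank_le U
  refine ⟨fun i j => if h : (j : ℕ) < Module.finrank F U then (b ⟨j, h⟩ : Fin d → F) i else 0, ?_⟩
  apply le_antisymm
  · rw [Submodule.span_le]
    rintro _ ⟨j, rfl⟩
    by_cases h : (j : ℕ) < Module.finrank F U
    · simp [h]
    · simp only [h, dite_false]
      exact U.zero_mem
  · have : U = Submodule.span F (Set.range fun j => (b j : Fin d → F)) := by
      have := congrArg (Submodule.map U.subtype) b.span_eq
      rw [Submodule.map_span, Submodule.map_top, Submodule.range_subtype, ← Set.range_comp] at this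
      exact this.symm
    conv_lhs => rw [this]
    apply Submodule.span_mono
    rintro _ ⟨j, rfl⟩
    exact ⟨⟨j, j.2.trans_le hle⟩, by ext i; simp⟩

variable [StarRing F]

/-- The form on `F^d` with diagonal Gram matrix `α`. -/
def diagForm {d : ℕ} (α : Fin d → F) : (Fin d → F) →ₗ⋆[F] (Fin d → F) →ₗ[F] F :=
  LinearMap.mk₂'ₛₗ (starRingEnd F) (RingHom.id F) (fun x y => ∑ i, star (x i) * α i * y i)
    (fun x x' y => by simp [add_mul, Finset.sum_add_distrib])
    (fun c x y => by simp [Finset.mul_sum, mul_assoc, starRingEnd_apply])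
    (fun x y y' => by simp [mul_add, Finset.sum_add_distrib])
    (fun c x y => by simp [Finset.mul_sum, mul_left_comm])

@[simp]
theorem diagForm_apply {d : ℕ} (α x y : Fin d → F) :
    diagForm α x y = ∑ i, star (x i) * α i * y i := rfl

theorem mem_orthogonalBilin_span {B : V →ₗ⋆[F] V →ₗ[F] F} {S : Set V} {y : V} :
    y ∈ (Submodule.span F S).orthogonalBilin B ↔ ∀ x ∈ S, B x y = 0 := by
  refine ⟨fun h x hx => h x (Submodule.subset_span hx), fun h x hx => ?_⟩
  induction hx using Submodule.span_induction with
  | mem x hx => exact h x hx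
  | zero => simp
  | add x z _ _ hx hz => simp [hx, hz]
  | smul c x _ hx => simp [hx]

end LinearAlgebra

/-! ### Terms and quantifier free formulas over a language containing that of `*`-rings -/

section Terms

variable {L : FirstOrder.Language.{0, 0}} (ι : ∀ ⦃n : ℕ⦄, StarRingFunc n → L.Functions n) {X : Type} {d : ℕ}

/-- The term `0`. -/
def zeroTerm : L.Term X := .func (ι .zero) ![]

/-- The term `1`. -/
def oneTerm : L.Term X := .func (ι .one) ![]

/-- The term `s + t`. -/
def addTerm (s t : L.Term X) : L.Term X := .func (ι .add) ![s, t]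

/-- The term `s * t`. -/
def mulTerm (s t : L.Term X) : L.Term X := .func (ι .mul) ![s, t]

/-- The term `-t`. -/
def negTerm (t : L.Term X) : L.Term X := .func (ι .neg) ![t]

/-- The term `t^*`. -/
def starTerm (t : L.Term X) : L.Term X := .func (ι .star) ![t]

/-- The term for a natural number. -/
def natTerm : ℕ → L.Term X
  | 0 => zeroTerm ι
  | n + 1 => addTerm ι (natTerm n) (oneTerm ι)

/-- The term for an integer. -/
def intTerm : ℤ → L.Term X
  | .ofNat n => natTerm ι n
  | .negSucc n => negTerm ι (natTerm ι (n + 1))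

/-- The term for the dot product of two vectors of terms. -/
def dotTerm (f w : Fin d → L.Term X) : L.Term X :=
  (List.ofFn fun i => mulTerm ι (f i) (w i)).foldr (addTerm ι) (zeroTerm ι)

/-- The vector of terms for `(f ⬝ w) w' - (f ⬝ w') w`. -/
def elimTerm (f w w' : Fin d → L.Term X) : Fin d → L.Term X := fun i =>
  addTerm ι (mulTerm ι (dotTerm ι f w) (w' i)) (negTerm ι (mulTerm ι (dotTerm ι f w') (w i)))

/-- The vector of terms for the `j`-th standard basis vector. -/
def singleTerm (j : Fin d) : Fin d → L.Term X := fun i => if i = j then oneTerm ι else zeroTerm ι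

/-- The formula expressing that the dot product with `f` vanishes on `W`. -/
def vanishFormula (f : Fin d → L.Term X) (W : List (Fin d → L.Term X)) : L.Formula X :=
  (W.map fun w => (dotTerm ι f w).equal (zeroTerm ι)).foldr (· ⊓ ·) ⊤

/-- The formula expressing that `k` holds of generators of the subspace of those vectors in the
span of `W` that are annihilated by `fs`. -/
def meetFormula : List (Fin d → L.Term X) → List (Fin d → L.Term X) →
    (List (Fin d → L.Term X) → L.Formula X) → L.Formula X
  | [], W, k => k W
  | f :: fs, W, k =>
    (vanishFormula ι f W ⊓ meetFormula fs W k) ⊔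
      ((vanishFormula ι f W).not ⊓
        meetFormula fs (W.flatMap fun w => W.map fun w' => elimTerm ι f w w') k)

/-- The formula expressing that `k` holds of generators of the annihilator of `fs`. -/
def annFormula (fs : List (Fin d → L.Term X)) (k : List (Fin d → L.Term X) → L.Formula X) :
    L.Formula X :=
  meetFormula ι fs (List.ofFn (singleTerm ι)) k

/-- The formula expressing that the span of `W` is contained in the span of `W'`. -/
def leFormula (W W' : List (Fin d → L.Term X)) : L.Formula X :=
  annFormula ι W' fun P => (P.map fun p => vanishFormula ι p W).foldr (· ⊓ ·) ⊤

theorem isQF_foldr_inf (l : List (L.Formula X)) (h : ∀ φ ∈ l, φ.IsQF) :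
    (l.foldr (· ⊓ ·) ⊤).IsQF := by
  induction l with
  | nil => exact BoundedFormula.IsQF.top
  | cons φ l ih =>
    exact (h φ (by simp)).inf (ih fun ψ hψ => h ψ (by simp [hψ]))

theorem isQF_vanishFormula (f : Fin d → L.Term X) (W : List (Fin d → L.Term X)) :
    (vanishFormula ι f W).IsQF := by
  apply isQF_foldr_inf
  intro φ hφ
  obtain ⟨w, -, rfl⟩ := List.mem_map.1 hφ
  exact (BoundedFormula.IsAtomic.equal _ _).isQF

theorem isQF_meetFormula (fs W : List (Fin d → L.Term X))
    (k : List (Fin d → L.Term X) → L.Formula X) (hk : ∀ P, (k P).IsQF) :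
    (meetFormula ι fs W k).IsQF := by
  induction fs generalizing W with
  | nil => exact hk W
  | cons f fs ih =>
    exact ((isQF_vanishFormula ι f W).inf (ih _)).sup ((isQF_vanishFormula ι f W).not.inf (ih _))

theorem isQF_leFormula (W W' : List (Fin d → L.Term X)) : (leFormula ι W W').IsQF := by
  apply isQF_meetFormula
  intro P
  apply isQF_foldr_inf
  intro φ hφ
  obtain ⟨p, -, rfl⟩ := List.mem_map.1 hφ
  exact isQF_vanishFormula ι p W

theorem realize_foldr_inf_formula {M : Type u} [L.Structure M]
    (l : List (L.Formula X)) (v : X → M) :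
    (l.foldr (· ⊓ ·) ⊤ : L.Formula X).Realize v ↔ ∀ φ ∈ l, φ.Realize v := by
  simp [Formula.Realize, BoundedFormula.realize_foldr_inf]

variable (F : Type u) [Field F] [StarRing F] [L.Structure F]

/-- The symbols `ι` of `L` are interpreted as the operations of the `*`-field `F`. -/
def Interprets : Prop :=
  ∀ ⦃n : ℕ⦄ (f : StarRingFunc n) (x : Fin n → F),
    Structure.funMap (ι f) x = (starStructure F).funMap f x

variable {ι F}

theorem Interprets.realize_zeroTerm (hι : Interprets ι F) (v : X → F) :
    (zeroTerm ι : L.Term X).realize v = 0 := hι _ _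

theorem Interprets.realize_oneTerm (hι : Interprets ι F) (v : X → F) :
    (oneTerm ι : L.Term X).realize v = 1 := hι _ _

theorem Interprets.realize_addTerm (hι : Interprets ι F) (v : X → F) (s t : L.Term X) :
    (addTerm ι s t).realize v = s.realize v + t.realize v := hι _ _

theorem Interprets.realize_mulTerm (hι : Interprets ι F) (v : X → F) (s t : L.Term X) :
    (mulTerm ι s t).realize v = s.realize v * t.realize v := hι _ _

theorem Interprets.realize_negTerm (hι : Interprets ι F) (v : X → F) (t : L.Term X) :
    (negTerm ι t).realize v = -t.realize v := hι _ _

theorem Interprets.realize_starTerm (hι : Interprets ι F) (v : X → F) (t : L.Term X) :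
    (starTerm ι t).realize v = star (t.realize v) := hι _ _

theorem Interprets.realize_natTerm (hι : Interprets ι F) (v : X → F) (n : ℕ) :
    (natTerm ι n : L.Term X).realize v = n := by
  induction n with
  | zero => simp [natTerm, hι.realize_zeroTerm]
  | succ n ih => simp [natTerm, hι.realize_addTerm, hι.realize_oneTerm, ih]

theorem Interprets.realize_intTerm (hι : Interprets ι F) (v : X → F) (n : ℤ) :
    (intTerm ι n : L.Term X).realize v = n := by
  cases n with
  | ofNat n => simp [intTerm, hι.realize_natTerm]
  | negSucc n => simp [intTerm, hι.realize_natTerm, hι.realize_negTerm]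

/-- The value of a vector of terms. -/
def vecVal (v : X → F) (w : Fin d → L.Term X) : Fin d → F := fun i => (w i).realize v

/-- The span of the values of a list of vectors of terms. -/
def spanVal (v : X → F) (W : List (Fin d → L.Term X)) : Submodule F (Fin d → F) :=
  Submodule.span F {x | ∃ w ∈ W, vecVal v w = x}

theorem Interprets.realize_dotTerm (hι : Interprets ι F) (v : X → F) (f w : Fin d → L.Term X) :
    (dotTerm ι f w).realize v = vecVal v f ⬝ᵥ vecVal v w := by
  have h : ∀ l : List (L.Term X),
      (l.foldr (addTerm ι) (zeroTerm ι)).realize v = (l.map (Term.realize v)).sum := by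
    intro l
    induction l with
    | nil => simp [hι.realize_zeroTerm]
    | cons t l ih => simp [hι.realize_addTerm, ih]
  rw [dotTerm, h, List.map_ofFn, List.sum_ofFn]
  simp [dotProduct, vecVal, hι.realize_mulTerm]

theorem Interprets.vecVal_elimTerm (hι : Interprets ι F) (v : X → F)
    (f w w' : Fin d → L.Term X) : vecVal v (elimTerm ι f w w') =
      (vecVal v f ⬝ᵥ vecVal v w) • vecVal v w' - (vecVal v f ⬝ᵥ vecVal v w') • vecVal v w := by
  ext i
  simp [elimTerm, vecVal, hι.realize_addTerm, hι.realize_mulTerm, hι.realize_negTerm,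
    hι.realize_dotTerm, sub_eq_add_neg]

theorem Interprets.realize_vanishFormula (hι : Interprets ι F) (v : X → F)
    (f : Fin d → L.Term X) (W : List (Fin d → L.Term X)) :
    (vanishFormula ι f W).Realize v ↔ ∀ w ∈ W, vecVal v f ⬝ᵥ vecVal v w = 0 := by
  simp [vanishFormula, realize_foldr_inf_formula, Formula.realize_equal, hι.realize_dotTerm,
    hι.realize_zeroTerm]

/-- The generators handed to `k` depend on the branch taken. Hence `k` is only required to have one
and the same truth value `P` on every list spanning the correct subspace. -/
theorem Interprets.realize_meetFormula (hι : Interprets ι F) (v : X → F)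
    (fs W : List (Fin d → L.Term X)) (k : List (Fin d → L.Term X) → L.Formula X) (P : Prop)
    (hk : ∀ T, (∀ x, x ∈ spanVal v T ↔ x ∈ spanVal v W ∧ ∀ f ∈ fs, vecVal v f ⬝ᵥ x = 0) →
      ((k T).Realize v ↔ P)) :
    (meetFormula ι fs W k).Realize v ↔ P := by
  induction fs generalizing W with
  | nil => exact hk W (by simp)
  | cons f fs ih =>
    have hsup : (meetFormula ι (f :: fs) W k).Realize v ↔
        ((vanishFormula ι f W).Realize v ∧ (meetFormula ι fs W k).Realize v) ∨
        (¬ (vanishFormula ι f W).Realize v ∧ (meetFormula ι fs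
          (W.flatMap fun w => W.map fun w' => elimTerm ι f w w') k).Realize v) := by
      simp [meetFormula, Formula.Realize]
    let g : (Fin d → F) →ₗ[F] F := dotProductBilin F F (vecVal v f)
    have hg : ∀ x, g x = vecVal v f ⬝ᵥ x := fun x => rfl
    rw [hsup]
    by_cases h : (vanishFormula ι f W).Realize v
    -- The span of `W` already lies in the kernel of `f`, so imposing `f` changes nothing.
    · simp only [h, true_and, not_true, false_and, or_false]
      apply ih
      intro T hT
      apply hk
      intro x
      rw [hT]
      rw [hι.realize_vanishFormula] at h
      have hle : spanVal v W ≤ LinearMap.ker g := by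
        rw [spanVal, Submodule.span_le]
        rintro _ ⟨w, hw, rfl⟩
        exact h w hw
      simp only [List.mem_cons, forall_eq_or_imp]
      exact and_congr_right fun hx => (and_iff_right (hle hx)).symm
    · simp only [h, false_and, false_or, not_false_eq_true, true_and]
      apply ih
      intro T hT
      apply hk
      intro x
      rw [hT]
      rw [hι.realize_vanishFormula] at h
      push Not at h
      obtain ⟨a, ha, hfa⟩ := h
      have := span_inf_ker_of_ne_zero g {x | ∃ w ∈ W, vecVal v w = x} ⟨a, ha, rfl⟩ hfa
      have hspan : spanVal v (W.flatMap fun w => W.map fun w' => elimTerm ι f w w') =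
          spanVal v W ⊓ LinearMap.ker g := by
        rw [spanVal, spanVal, this]
        congr 1
        ext y
        constructor
        · rintro ⟨t, ht, rfl⟩
          simp only [List.mem_flatMap, List.mem_map] at ht
          obtain ⟨w, hw, w', hw', rfl⟩ := ht
          exact ⟨_, ⟨w, hw, rfl⟩, _, ⟨w', hw', rfl⟩, (hι.vecVal_elimTerm v f w w').symm⟩
        · rintro ⟨_, ⟨w, hw, rfl⟩, _, ⟨w', hw', rfl⟩, rfl⟩
          refine ⟨elimTerm ι f w w', ?_, hι.vecVal_elimTerm v f w w'⟩
          simp only [List.mem_flatMap, List.mem_map]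
          exact ⟨w, hw, w', hw', rfl⟩
      rw [hspan, Submodule.mem_inf, LinearMap.mem_ker, hg]
      simp only [List.mem_cons, forall_eq_or_imp, and_assoc]

theorem Interprets.realize_annFormula (hι : Interprets ι F) (v : X → F)
    (fs : List (Fin d → L.Term X)) (k : List (Fin d → L.Term X) → L.Formula X) (P : Prop)
    (hk : ∀ T, (∀ x, x ∈ spanVal v T ↔ ∀ f ∈ fs, vecVal v f ⬝ᵥ x = 0) →
      ((k T).Realize v ↔ P)) :
    (annFormula ι fs k).Realize v ↔ P := by
  have htop : spanVal v (List.ofFn (singleTerm ι : Fin d → Fin d → L.Term X)) =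
      (⊤ : Submodule F (Fin d → F)) := by
    rw [eq_top_iff, ← (Pi.basisFun F (Fin d)).span_eq]
    apply Submodule.span_mono
    rintro _ ⟨j, rfl⟩
    refine ⟨singleTerm ι j, by simp [List.mem_ofFn], ?_⟩
    ext i
    by_cases h : i = j <;>
      simp [vecVal, singleTerm, h, hι.realize_oneTerm, hι.realize_zeroTerm]
  apply hι.realize_meetFormula
  simpa [htop] using hk

/-- Double annihilator argument for the dot product on `F^d`: a subspace contains exactly the
vectors killed by its annihilator, of which `T` is a finite generating list. -/
theorem Interprets.realize_leFormula (hι : Interprets ι F) (v : X → F)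
    (W W' : List (Fin d → L.Term X)) :
    (leFormula ι W W').Realize v ↔ spanVal v W ≤ spanVal v W' := by
  apply hι.realize_annFormula
  intro T hT
  simp only [realize_foldr_inf_formula, List.mem_map, forall_exists_index, and_imp,
    forall_apply_eq_imp_iff₂, hι.realize_vanishFormula]
  constructor
  · intro h
    rw [spanVal, Submodule.span_le]
    rintro _ ⟨w, hw, rfl⟩
    apply mem_of_dotProduct_annihilator
    intro p hp
    have hpT : p ∈ spanVal v T :=
      (hT p).2 fun f hf => hp _ (Submodule.subset_span ⟨f, hf, rfl⟩)
    clear hp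
    rw [spanVal] at hpT
    induction hpT using Submodule.span_induction with
    | mem x hx =>
      obtain ⟨t, ht, rfl⟩ := hx
      exact h t ht w hw
    | zero => simp
    | add x y _ _ hx hy => simp [add_dotProduct, hx, hy]
    | smul c x _ hx => simp [smul_dotProduct, hx]
  · intro h t ht w hw
    have hw' : vecVal v w ∈ spanVal v W' := h (Submodule.subset_span ⟨w, hw, rfl⟩)
    have ht' := (hT (vecVal v t)).1 (Submodule.subset_span ⟨t, ht, rfl⟩)
    rw [dotProduct_comm]
    generalize vecVal v w = z at hw' ⊢
    rw [spanVal] at hw'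
    induction hw' using Submodule.span_induction with
    | mem x hx =>
      obtain ⟨t', ht'', rfl⟩ := hx
      exact ht' t' ht''
    | zero => simp
    | add x y _ _ hx hy => simp [add_dotProduct, hx, hy]
    | smul c x _ hx => simp [smul_dotProduct, hx]

end Terms

/-! ### The translation -/

section Translation

variable {L : FirstOrder.Language.{0, 0}} (ι : ∀ ⦃n : ℕ⦄, StarRingFunc n → L.Functions n)
  {X : Type} {d : ℕ} (w : Fin d → L.Term Empty)

/-- The vector of terms for the functional `⟨u | ·⟩` with respect to the weights `w`. -/
def dualTerm (u : Fin d → L.Term X) : Fin d → L.Term X := fun i =>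
  mulTerm ι (starTerm ι (u i)) ((w i).relabel Empty.elim)

/-- The formula expressing that `k` holds of generators of the value of the lattice term `t`,
the variables of `t` being the column spans of matrices of variables. -/
def genFormula : latLang.Term X →
    (List (Fin d → L.Term (X × Fin d × Fin d)) → L.Formula (X × Fin d × Fin d)) →
    L.Formula (X × Fin d × Fin d)
  | .var x, k => k (List.ofFn fun j i => .var (x, i, j))
  | .func (l := 0) LatFunc.zero _, k => k []
  | .func (l := 2) LatFunc.add ts, k =>
    genFormula (ts 0) fun W => genFormula (ts 1) fun W' => k (W ++ W')
  | .func (l := 1) LatFunc.perp ts, k =>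
    genFormula (ts 0) fun W => annFormula ι (W.map (dualTerm ι w)) k

/-- The translation of lattice formulas into formulas of `*`-rings with weights `w`. -/
noncomputable def translate : ∀ {m : ℕ}, latLang.BoundedFormula X m →
    L.Formula ((X ⊕ Fin m) × Fin d × Fin d)
  | _, .falsum => ⊥
  | _, .equal s t => genFormula ι w s fun W => genFormula ι w t fun W' =>
      leFormula ι W W' ⊓ leFormula ι W' W
  | _, .rel r _ => r.elim
  | _, .imp φ ψ => (translate φ).imp (translate ψ)
  | _, .all φ => Formula.iAlls (Fin d × Fin d) ((translate φ).relabel fun p =>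
      Sum.elim (fun x => .inl (.inl x, p.2))
        (Fin.lastCases (.inr p.2) fun i => .inl (.inr i, p.2)) p.1)

/-- The translation of lattice formulas without dangling bound variables. -/
noncomputable def translateFormula (φ : latLang.Formula X) : L.Formula (X × Fin d × Fin d) :=
  (translate ι w φ).relabel (Prod.map (Sum.elim id Fin.elim0) id)

theorem isQF_genFormula (t : latLang.Term X)
    (k : List (Fin d → L.Term (X × Fin d × Fin d)) → L.Formula (X × Fin d × Fin d))
    (hk : ∀ W, (k W).IsQF) : (genFormula ι w t k).IsQF := by
  induction t generalizing k with
  | var x => exact hk _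
  | func f ts ih =>
    cases f with
    | zero => exact hk _
    | add => exact ih 0 _ fun W => ih 1 _ fun W' => hk _
    | perp => exact ih 0 _ fun W => isQF_meetFormula ι _ _ _ hk

theorem isQF_translate {m : ℕ} {φ : latLang.BoundedFormula X m} (h : φ.IsQF) :
    (translate ι w φ).IsQF := by
  induction h with
  | falsum => exact BoundedFormula.isQF_bot
  | of_isAtomic h =>
    cases h with
    | equal s t =>
      exact isQF_genFormula ι w s _ fun W => isQF_genFormula ι w t _ fun W' =>
        (isQF_leFormula ι W W').inf (isQF_leFormula ι W' W)
    | rel r ts => exact r.elim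
  | imp _ _ h₁ h₂ => exact h₁.imp h₂

theorem isQF_translateFormula {φ : latLang.Formula X} (h : φ.IsQF) :
    (translateFormula ι w φ).IsQF :=
  (isQF_translate ι w h).relabel _

variable {F : Type u} [Field F] [StarRing F] [L.Structure F] {ι w}
  {α : Fin d → F} {c : F}

/-- The column space of a matrix. -/
def colSpace (A : Matrix (Fin d) (Fin d) F) : Submodule F (Fin d → F) :=
  Submodule.span F (Set.range fun j i => A i j)

/-- The tuple of column spaces of a tuple of matrices. -/
def colSpaces (a : X × Fin d × Fin d → F) (x : X) : Submodule F (Fin d → F) :=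
  colSpace fun i j => a (x, i, j)

/-- Weights proportional to `α` suffice, since scaling the form by `c ≠ 0` leaves orthocomplements
unchanged. This freedom is what later allows denominators to be cleared. -/
theorem Interprets.realize_genFormula (hι : Interprets ι F) (hc : c ≠ 0)
    (hw : ∀ i, (w i).realize (Empty.elim : Empty → F) = c * α i) (t : latLang.Term X)
    (a : X × Fin d × Fin d → F)
    (k : List (Fin d → L.Term (X × Fin d × Fin d)) → L.Formula (X × Fin d × Fin d)) (P : Prop)
    (hk : letI := latStructure (diagForm α)
      ∀ W, spanVal a W = t.realize (colSpaces a) → ((k W).Realize a ↔ P)) :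
    (genFormula ι w t k).Realize a ↔ P := by
  let := latStructure (diagForm α)
  induction t generalizing k with
  | var x =>
    apply hk
    simp only [spanVal, Term.realize_var, colSpaces, colSpace]
    congr 1
    ext y
    simp only [List.mem_ofFn, Set.mem_ofPred_eq, Set.mem_range]
    constructor
    · rintro ⟨_, ⟨j, rfl⟩, rfl⟩
      exact ⟨j, rfl⟩
    · rintro ⟨j, rfl⟩
      exact ⟨_, ⟨j, rfl⟩, rfl⟩
  | func f ts ih =>
    cases f with
    | zero =>
      apply hk
      change spanVal a [] = ⊥
      simp [spanVal]
    | add =>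
      apply ih 0
      intro W hW
      apply ih 1
      intro W' hW'
      apply hk
      change _ = (ts 0).realize (colSpaces a) ⊔ (ts 1).realize (colSpaces a)
      rw [← hW, ← hW', spanVal, spanVal, spanVal, ← Submodule.span_union]
      congr 1
      ext y
      simp only [List.mem_append, Set.mem_ofPred_eq, Set.mem_union, or_and_right, exists_or]
    | perp =>
      apply ih 0
      intro W hW
      apply hι.realize_annFormula
      intro T hT
      apply hk
      change _ = ((ts 0).realize (colSpaces a)).orthogonalBilin (diagForm α)
      rw [← hW, spanVal]
      ext y
      rw [← spanVal, hT, spanVal, mem_orthogonalBilin_span]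
      have key : ∀ u, vecVal a (dualTerm ι w u) ⬝ᵥ y = c * diagForm α (vecVal a u) y := by
        intro u
        have : (a ∘ Empty.elim : Empty → F) = Empty.elim := Subsingleton.elim _ _
        simp only [dotProduct, vecVal, dualTerm, hι.realize_mulTerm, hι.realize_starTerm,
          Term.realize_relabel, this, hw, diagForm_apply, Finset.mul_sum]
        exact Finset.sum_congr rfl fun i _ => by ring
      simp only [List.mem_map, forall_exists_index, and_imp, forall_apply_eq_imp_iff₂,
        Set.mem_ofPred_eq, key, mul_eq_zero, hc, false_or]

theorem Interprets.realize_translate (hι : Interprets ι F) (hc : c ≠ 0)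
    (hw : ∀ i, (w i).realize (Empty.elim : Empty → F) = c * α i) {m : ℕ}
    (φ : latLang.BoundedFormula X m) (a : (X ⊕ Fin m) × Fin d × Fin d → F) :
    letI := latStructure (diagForm α)
    (translate ι w φ).Realize a ↔
      φ.Realize (fun x => colSpaces a (.inl x)) (fun i => colSpaces a (.inr i)) := by
  let := latStructure (diagForm α)
  change (translate ι w φ).Realize a ↔
      φ.Realize (fun x => colSpaces a (.inl x)) (fun i => colSpaces a (.inr i))
  induction φ with
  | falsum => rfl
  | equal s t =>
    apply hι.realize_genFormula hc hw
    intro W hW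
    apply hι.realize_genFormula hc hw
    intro W' hW'
    rw [Formula.realize_inf, hι.realize_leFormula, hι.realize_leFormula, ← le_antisymm_iff, hW, hW',
      BoundedFormula.Realize, ← Sum.elim_comp_inl_inr (colSpaces a)]
    rfl
  | rel r _ => exact r.elim
  | imp φ ψ h₁ h₂ =>
    rw [BoundedFormula.realize_imp, ← h₁, ← h₂]
    rfl
  | all φ ih =>
    rw [translate, Formula.realize_iAlls, BoundedFormula.realize_all]
    -- The relabelling sends the newest bound lattice variable to the quantified matrix `A` and
    -- leaves all others to `a`.
    have key : ∀ A : Fin d × Fin d → F, ((translate ι w φ).relabel fun p =>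
        Sum.elim (fun x => Sum.inl (Sum.inl x, p.2))
        (Fin.lastCases (Sum.inr p.2) fun i => Sum.inl (Sum.inr i, p.2)) p.1).Realize
          (fun b => Sum.elim a A b) ↔ φ.Realize (fun x => colSpaces a (.inl x))
            (Fin.snoc (fun i => colSpaces a (.inr i)) (colSpace fun i j => A (i, j))) := by
      intro A
      rw [Formula.realize_relabel, ih]
      refine iff_of_eq (congrArg₂ _ rfl ?_)
      ext1 i
      refine Fin.lastCases ?_ (fun i => ?_) i <;> simp [colSpaces]
    simp only [key]
    constructor
    · intro h U
      -- Every subspace of `F^d` is a column space, so the matrix quantifier reaches all of them.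
      obtain ⟨A, rfl⟩ := exists_span_range_eq U
      exact h fun p => A p.1 p.2
    · intro h A
      exact h _

theorem Interprets.realize_translateFormula (hι : Interprets ι F) (hc : c ≠ 0)
    (hw : ∀ i, (w i).realize (Empty.elim : Empty → F) = c * α i)
    (φ : latLang.Formula X) (a : X × Fin d × Fin d → F) :
    letI := latStructure (diagForm α)
    (translateFormula ι w φ).Realize a ↔ φ.Realize (colSpaces a) := by
  let := latStructure (diagForm α)
  change (translateFormula ι w φ).Realize a ↔ φ.Realize (colSpaces a)
  rw [translateFormula, Formula.realize_relabel, hι.realize_translate hc hw, Formula.Realize]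
  exact iff_of_eq (congrArg₂ _ rfl (Subsingleton.elim _ _))

end Translation

/-! ### Coordinates -/

section Coordinates

variable {F : Type u} [Field F] [StarRing F] {V : Type v} [AddCommGroup V] [Module F V] {d : ℕ}
  [NeZero d]

/-- The Gram matrix of `v` is `|v₁|` times the diagonal matrix of `α`. -/
theorem IsPerpBasis.apply_eq {B : V →ₗ⋆[F] V →ₗ[F] F} {α : Fin d → F}
    {v : Module.Basis (Fin d) F V} (hv : IsPerpBasis B α v) (h0 : B (v 0) (v 0) ≠ 0) (x y : V) :
    B x y = B (v 0) (v 0) * diagForm α (v.equivFun x) (v.equivFun y) := by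
  have hd : ∀ i, B (v i) (v i) = B (v 0) (v 0) * α i := by
    intro i
    rw [hv.ratio i, mul_inv_cancel_left₀ h0]
  conv_lhs => rw [← v.sum_equivFun x, ← v.sum_equivFun y]
  simp only [map_sum, LinearMap.sum_apply, diagForm_apply, Finset.mul_sum]
  refine Finset.sum_congr rfl fun i _ => ?_
  rw [Finset.sum_eq_single i]
  · rw [LinearMap.map_smulₛₗ₂, map_smul, hd, starRingEnd_apply, smul_eq_mul, smul_eq_mul]
    ring
  · intro j _ hj
    simp [hv.orthogonal j i hj]
  · simp

/-- A `⊥`-basis identifies the lattice of subspaces of `V` with that of `F^d`. -/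
noncomputable def IsPerpBasis.latEquiv {B : V →ₗ⋆[F] V →ₗ[F] F} {α : Fin d → F}
    {v : Module.Basis (Fin d) F V} (hv : IsPerpBasis B α v) (h0 : B (v 0) (v 0) ≠ 0) :
    letI := latStructure B
    letI := latStructure (diagForm α)
    Submodule F V ≃[latLang] Submodule F (Fin d → F) :=
  letI := latStructure B
  letI := latStructure (diagForm α)
  { (Submodule.orderIsoMapComap v.equivFun).toEquiv with
    map_fun' := by
      intro n f x
      cases f with
      | zero => exact (Submodule.orderIsoMapComap v.equivFun).map_bot
      | add => exact (Submodule.orderIsoMapComap v.equivFun).map_sup _ _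
      | perp =>
        change ((x 0).orthogonalBilin B).map (v.equivFun : V →ₗ[F] (Fin d → F)) =
          ((x 0).map (v.equivFun : V →ₗ[F] (Fin d → F))).orthogonalBilin (diagForm α)
        have key : ∀ u y, B u y = 0 ↔ diagForm α (v.equivFun u) (v.equivFun y) = 0 := fun u y => by
          rw [hv.apply_eq h0, mul_eq_zero_iff_left h0]
        ext y
        rw [Submodule.mem_map_equiv]
        simp only [Submodule.mem_orthogonalBilin_iff, Submodule.mem_map, forall_exists_index,
          and_imp, forall_apply_eq_imp_iff₂, key, LinearEquiv.apply_symm_apply]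
        rfl
    map_rel' := fun r => r.elim }

theorem IsPerpBasis.realize_iff {B : V →ₗ⋆[F] V →ₗ[F] F} {α : Fin d → F}
    {v : Module.Basis (Fin d) F V} (hv : IsPerpBasis B α v) (h0 : B (v 0) (v 0) ≠ 0)
    {n : ℕ} (φ : latLang.Formula (Fin n)) (A : Fin n → Matrix (Fin d) (Fin d) F) :
    @Formula.Realize latLang _ (latStructure B) _ φ (fun k => colSpan v (A k)) ↔
      @Formula.Realize latLang _ (latStructure (diagForm α)) _ φ (colSpaces (entries A)) := by
  let := latStructure B
  let := latStructure (diagForm α)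
  rw [← StrongHomClass.realize_formula (hv.latEquiv h0) φ]
  refine iff_of_eq (congrArg _ ?_)
  ext1 k
  change (colSpan v (A k)).map (v.equivFun : V →ₗ[F] (Fin d → F)) =
    Submodule.span F (Set.range fun j i => A k i j)
  rw [colSpan, Submodule.map_span, ← Set.range_comp]
  congr 2
  ext j i
  simp [Finsupp.single_apply]

theorem IsPerpBasis.apply_zero_ne_zero {B : V →ₗ⋆[F] V →ₗ[F] F} {α : Fin d → F}
    {v : Module.Basis (Fin d) F V} (hv : IsPerpBasis B α v) (hα : IsAdmissible B α) :
    B (v 0) (v 0) ≠ 0 := by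
  intro h
  -- With `0⁻¹ = 0`, an isotropic first basis vector would force `α 0 = 0`.
  exact hα.ne_zero 0 (by rw [hv.ratio 0, h, mul_zero])

/-- The right-hand side does not mention a basis: membership for one `⊥`-basis is membership for
all, and admissibility provides at least one. -/
theorem IsAdmissible.mem_theta_iff {B : V →ₗ⋆[F] V →ₗ[F] F} {α : Fin d → F}
    (hα : IsAdmissible B α) {n : ℕ} {φ : latLang.Formula (Fin n)}
    {M : Set (Fin n → Submodule F V)} (hM : DefinesSub B φ M)
    (A : Fin n → Matrix (Fin d) (Fin d) F) :
    A ∈ theta B α M ↔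
      @Formula.Realize latLang _ (latStructure (diagForm α)) _ φ (colSpaces (entries A)) := by
  constructor
  · rintro ⟨v, hv, hA⟩
    exact (hv.realize_iff (hv.apply_zero_ne_zero hα) φ A).1 ((hM _).1 hA)
  · intro h
    obtain ⟨v, hv⟩ := hα.exists_basis
    exact ⟨v, hv, (hM _).2 ((hv.realize_iff (hv.apply_zero_ne_zero hα) φ A).2 h)⟩

end Coordinates

/-! ### Eliminating constants from the prime field -/

theorem exists_common_denominator {F : Type u} [Field F] {d : ℕ} (α : Fin d → F)
    (hα : ∀ i, α i ∈ (⊥ : Subfield F)) :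
    ∃ (c : ℤ) (a : Fin d → ℤ), (c : F) ≠ 0 ∧ ∀ i, (a i : F) = c * α i := by
  have h : ∀ i, ∃ b a : ℤ, (b : F) ≠ 0 ∧ (a : F) = b * α i := by
    intro i
    have hi := hα i
    rw [← Subfield.closure_empty, Subfield.mem_closure_iff] at hi
    obtain ⟨y, hy, z, hz, hyz⟩ := hi
    rw [Subring.closure_empty, Subring.mem_bot] at hy hz
    obtain ⟨a, rfl⟩ := hy
    obtain ⟨b, rfl⟩ := hz
    by_cases hb : (b : F) = 0
    -- A zero denominator makes the quotient `0` by convention, so `0 / 1` replaces it.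
    · exact ⟨1, 0, by simp, by simp [← hyz, hb]⟩
    · exact ⟨b, a, hb, by rw [← hyz, mul_div_cancel₀ _ hb]⟩
  choose b a hb ha using h
  refine ⟨∏ i, b i, fun i => a i * ∏ j ∈ Finset.univ.erase i, b j, ?_, fun i => ?_⟩
  · push_cast
    exact Finset.prod_ne_zero_iff.2 fun i _ => hb i
  · rw [← Finset.mul_prod_erase _ _ (Finset.mem_univ i)]
    push_cast
    rw [ha]
    ring

/-- The symbols of `Λ_F` as symbols of `Λ_F⁺`. -/
def plusFunc (d : ℕ) ⦃n : ℕ⦄ (f : StarRingFunc n) : (starLangPlus d).Functions n := Sum.inl f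

/-- The symbols of `Λ_F` as symbols of `Λ_F`. -/
def idFunc ⦃n : ℕ⦄ (f : StarRingFunc n) : starLang.Functions n := f

/-- The constant `c_i`. -/
def constTerm {d : ℕ} (i : Fin d) : (starLangPlus d).Term Empty :=
  .func (l := 0) (Sum.inr i) ![]

end SubspaceTranslation

/-! ### The main theorem -/

open SubspaceTranslation in
theorem theorem6 (d : ℕ) [NeZero d] :
    ∃ τ : ∀ n : ℕ, latLang.Formula (Fin n) →
        (starLangPlus d).Formula (Fin n × Fin d × Fin d),
      -- quantifier-freeness is preserved
      (∀ (n : ℕ) (φ : latLang.Formula (Fin n)), φ.IsQF → (τ n φ).IsQF) ∧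
      -- correctness, uniformly in the field, the space and the form constants
      (∀ (F : Type u) [Field F] [StarRing F] (V : Type v) [AddCommGroup V] [Module F V]
          (B : V →ₗ⋆[F] V →ₗ[F] F) (_ : IsForm B) (_ : Module.finrank F V = d)
          (α : Fin d → F) (_ : IsAdmissible B α)
          (n : ℕ) (φ : latLang.Formula (Fin n)) (M : Set (Fin n → Submodule F V)),
          DefinesSub B φ M → DefinesMatPlus α (τ n φ) (theta B α M)) ∧
      -- form constants in the prime subfield: the constants can be eliminated
      (∀ (F : Type u) [Field F] [StarRing F] (α : Fin d → F),
          (∀ i, α i ∈ (⊥ : Subfield F)) →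
          ∃ τ₀ : ∀ n : ℕ, latLang.Formula (Fin n) → starLang.Formula (Fin n × Fin d × Fin d),
            (∀ (n : ℕ) (φ : latLang.Formula (Fin n)), φ.IsQF → (τ₀ n φ).IsQF) ∧
            (∀ (n : ℕ) (φ : latLang.Formula (Fin n))
              (K : Set (Fin n → Matrix (Fin d) (Fin d) F)),
              DefinesMatPlus α (τ n φ) K ↔ DefinesMat (τ₀ n φ) K) ∧
            (∀ (V : Type v) [AddCommGroup V] [Module F V]
              (B : V →ₗ⋆[F] V →ₗ[F] F) (_ : IsForm B) (_ : Module.finrank F V = d)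
              (_ : IsAdmissible B α)
              (n : ℕ) (φ : latLang.Formula (Fin n)) (M : Set (Fin n → Submodule F V)),
              DefinesSub B φ M → DefinesMat (τ₀ n φ) (theta B α M))) := by
  have hplus : ∀ (F : Type u) [Field F] [StarRing F] (α : Fin d → F) (n : ℕ)
      (φ : latLang.Formula (Fin n)) (A : Fin n → Matrix (Fin d) (Fin d) F),
      @FirstOrder.Language.Formula.Realize _ _ (starStructurePlus α) _
        (translateFormula (plusFunc d) constTerm φ) (entries A) ↔
      @FirstOrder.Language.Formula.Realize latLang _ (latStructure (diagForm α)) _ φ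
        (colSpaces (entries A)) := by
    intro F _ _ α n φ A
    let := starStructurePlus α
    have hι : Interprets (plusFunc d) F := fun _ _ _ => rfl
    -- The constants `c_i` denote `α_i` exactly, so the scaling factor is `1`.
    exact hι.realize_translateFormula one_ne_zero (fun i => (one_mul (α i)).symm ▸ rfl) φ _
  refine ⟨fun n φ => translateFormula (plusFunc d) constTerm φ,
    fun n φ => isQF_translateFormula _ _, ?_, ?_⟩
  · intro F _ _ V _ _ B _ _ α hα n φ M hM A
    rw [hα.mem_theta_iff hM, hplus]
  · intro F _ _ α hα
    obtain ⟨c, a, hc, ha⟩ := exists_common_denominator α hα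
    have hint : ∀ (n : ℕ) (φ : latLang.Formula (Fin n)) (A : Fin n → Matrix (Fin d) (Fin d) F),
        @FirstOrder.Language.Formula.Realize _ _ (starStructure F) _
          (translateFormula idFunc (fun i => intTerm idFunc (a i)) φ) (entries A) ↔
        @FirstOrder.Language.Formula.Realize latLang _ (latStructure (diagForm α)) _ φ
          (colSpaces (entries A)) := by
      intro n φ A
      let := starStructure F
      have hι : Interprets idFunc F := fun _ _ _ => rfl
      -- The integer weights `a i` are `α i` scaled by the common denominator `c`.
      exact hι.realize_translateFormula hc
        (fun i => (hι.realize_intTerm _ _).trans (ha i)) φ _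
    refine ⟨fun n φ => translateFormula idFunc (fun i => intTerm idFunc (a i)) φ,
      fun n φ => isQF_translateFormula _ _, ?_, ?_⟩
    · intro n φ K
      refine forall_congr' fun A => iff_congr Iff.rfl ?_
      -- Both formulas express the truth of `φ` for subspaces of `F^d` with weights `α`, which makes
      -- sense even when no space admits `α`.
      rw [hplus, hint]
    · intro V _ _ B _ _ hadm n φ M hM A
      rw [hadm.mem_theta_iff hM, hint]
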